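/- Let ${\cal H}_A$ and ${\cal H}_B$ be finite-dimensional complex Hilbert spaces, and let $N,K$ be integers with $0\le K<N$. Let $\Lambda_{AB}$ be an operator on ${\cal H}_A\otimes{\cal H}_B$ (not necessarily of trace one), and let $\Lambda_{AB^N}$ be an $N$ Bose symmetric extension of $\Lambda_{AB}$, i.e., an operator on ${\cal H}_A\otimes{\cal H}_B^{\otimes N}$ such that 1. $\Lambda_{AB^N}\ge 0$; 2. $\mathrm{tr}_{B^{N-1}}(\Lambda_{AB^N})=\Lambda_{AB}$ (all copies of $B$ but the first are traced out); 3. $\Lambda_{AB^N}({\mathbb I}_A\otimes P^N_{\mathrm{sym}})=\Lambda_{AB^N}$, where $P^N_{\mathrm{sym}}$ is the projector onto the symmetric subspace of ${\cal H}_B^{\otimes N}$. Suppose that $\Lambda_{AB^N}$ is PPT across the partition $AB^K|B^{N-K}$, i.e., that its partial transpose on the last $N-K$ copies of $B$ is positive semidefinite. Let $\Lambda_{AB^K}$ and $\Lambda_{B^{N-K}}$ be the reduced operators of $\Lambda_{AB^N}$ on the two sides of this partition (for $K=0$, $\Lambda_{AB^K}$ is the reduced operator on $A$). If $$\mathrm{rank}(\Lambda_{AB^N})\le\max\{\mathrm{rank}(\Lambda_{AB^K}),\mathrm{rank}(\Lambda_{B^{N-K}})\},$$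 then $\Lambda_{AB}$ is separable, i.e., $\Lambda_{AB}=\sum_i p_i\,|u_i\rangle\langle u_i|\otimes|v_i\rangle\langle v_i|$ for finitely many $p_i\ge0$, $u_i\in{\cal H}_A$, $v_i\in{\cal H}_B$. -/

import Mathlib

open scoped Matrix Kronecker Nat ComplexOrder

namespace RankLoop

/-- The unnormalised projector `|u⟩⟨u|`. -/
def proj {m : Type*} (u : m → ℂ) : Matrix m m ℂ :=
  Matrix.vecMulVec u (star u)

/-- A bipartite operator is separable: it lies in the cone generated by the product
projectors `|u⟩⟨u| ⊗ |v⟩⟨v|`. -/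
def IsSeparable {m n : Type*} (X : Matrix (m × n) (m × n) ℂ) : Prop :=
  ∃ (r : ℕ) (p : Fin r → ℝ) (u : Fin r → m → ℂ) (v : Fin r → n → ℂ),
    (∀ i, 0 ≤ p i) ∧ X = ∑ i, (p i : ℂ) • (proj (u i) ⊗ₖ proj (v i))

/-- Partial trace over the second tensor factor. -/
def traceSnd {m n : Type*} [Fintype n] (X : Matrix (m × n) (m × n) ℂ) : Matrix m m ℂ :=
  Matrix.of fun i i' => ∑ j, X (i, j) (i', j)

/-- Partial trace over the first tensor factor. -/
def traceFst {m n : Type*} [Fintype m] (X : Matrix (m × n) (m × n) ℂ) : Matrix n n ℂ :=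
  Matrix.of fun j j' => ∑ i, X (i, j) (i, j')

/-- Partial transposition of the second tensor factor. -/
def partialTranspose {m n : Type*} (X : Matrix (m × n) (m × n) ℂ) :
    Matrix (m × n) (m × n) ℂ :=
  Matrix.of fun i j => X (i.1, j.2) (j.1, i.2)

/-- The unitary that permutes the tensor factors of `(ℂ^b)^{⊗N}` according to `σ`. -/
def permOp (N : ℕ) (b : Type*) [DecidableEq b] (σ : Equiv.Perm (Fin N)) :
    Matrix (Fin N → b) (Fin N → b) ℂ :=
  Matrix.of fun x y => if x = y ∘ σ then 1 else 0

/-- The projector onto the symmetric subspace of `(ℂ^b)^{⊗N}`: the average of all the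
permutation operators. -/
noncomputable def symProj (N : ℕ) (b : Type*) [DecidableEq b] :
    Matrix (Fin N → b) (Fin N → b) ℂ :=
  ((N ! : ℕ) : ℂ)⁻¹ • ∑ σ : Equiv.Perm (Fin N), permOp N b σ

/-- Regroup `A ⊗ B^{⊗N}` as `(A ⊗ B) ⊗ B^{⊗(N-1)}`, singling out the first copy of `B`. -/
def firstSplit (a b : Type*) (N : ℕ) [NeZero N] :
    a × (Fin N → b) ≃ (a × b) × ({i : Fin N // i ≠ 0} → b) :=
  ((Equiv.refl a).prodCongr (Equiv.funSplitAt (0 : Fin N) b)).trans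
    (Equiv.prodAssoc a b _).symm

/-- Regroup `A ⊗ B^{⊗N}` as `(A ⊗ B^{⊗K}) ⊗ B^{⊗(N-K)}`: the first `K` copies of `B`
go with `A`. -/
def cutSplit (a b : Type*) (N K : ℕ) :
    a × (Fin N → b) ≃
      (a × ({i : Fin N // (i : ℕ) < K} → b)) × ({i : Fin N // ¬ (i : ℕ) < K} → b) :=
  ((Equiv.refl a).prodCongr
    (Equiv.piEquivPiSubtypeProd (fun i : Fin N => (i : ℕ) < K) (fun _ => b))).trans
    (Equiv.prodAssoc a _ _).symm

variable {a b : Type*} {N : ℕ}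

/-- An operator on `A ⊗ B^{⊗N}` seen as a bipartite operator across the cut
`A B^K | B^{N-K}`. -/
def cut (K : ℕ) (L : Matrix (a × (Fin N → b)) (a × (Fin N → b)) ℂ) :
    Matrix ((a × ({i : Fin N // (i : ℕ) < K} → b)) × ({i : Fin N // ¬ (i : ℕ) < K} → b))
      ((a × ({i : Fin N // (i : ℕ) < K} → b)) × ({i : Fin N // ¬ (i : ℕ) < K} → b)) ℂ :=
  Matrix.reindex (cutSplit a b N K) (cutSplit a b N K) L

/-- The reduced operator on `A` and the first `B`: all other copies of `B` are traced out. -/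
def reducedAB [Fintype b] [NeZero N]
    (L : Matrix (a × (Fin N → b)) (a × (Fin N → b)) ℂ) : Matrix (a × b) (a × b) ℂ :=
  traceSnd (Matrix.reindex (firstSplit a b N) (firstSplit a b N) L)

/-- The reduced operator on `A` and the first `K` copies of `B`. -/
def reducedABK [Fintype b] (K : ℕ)
    (L : Matrix (a × (Fin N → b)) (a × (Fin N → b)) ℂ) :
    Matrix (a × ({i : Fin N // (i : ℕ) < K} → b)) (a × ({i : Fin N // (i : ℕ) < K} → b)) ℂ :=
  traceSnd (cut K L)

/-- The reduced operator on the last `N - K` copies of `B`. -/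
def reducedBNK [Fintype a] [Fintype b] (K : ℕ)
    (L : Matrix (a × (Fin N → b)) (a × (Fin N → b)) ℂ) :
    Matrix ({i : Fin N // ¬ (i : ℕ) < K} → b) ({i : Fin N // ¬ (i : ℕ) < K} → b) ℂ :=
  traceFst (cut K L)

/-- `L` is an `N` Bose symmetric extension of `X`. -/
structure IsBSE [Fintype a] [Fintype b] [DecidableEq a] [DecidableEq b] [NeZero N]
    (X : Matrix (a × b) (a × b) ℂ)
    (L : Matrix (a × (Fin N → b)) (a × (Fin N → b)) ℂ) : Prop where
  posSemidef : L.PosSemidef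
  trace_eq : reducedAB L = X
  bose : L * ((1 : Matrix a a ℂ) ⊗ₖ symProj N b) = L

/-- `L` has positive partial transpose across the cut `A B^K | B^{N-K}`. -/
def IsPPT (K : ℕ) (L : Matrix (a × (Fin N → b)) (a × (Fin N → b)) ℂ) : Prop :=
  (partialTranspose (cut K L)).PosSemidef

end RankLoop

/-!
The operator is shown to be separable across the cut `A B^K | B^{N-K}`, and this passes to the
reduced operator.

The first step is a statement about bipartite operators (`isSeparable_of_rank_le_max`): a
positive semidefinite `X` on `ℂ^m ⊗ ℂ^n` with positive partial transpose and
`rank X ≤ max (rank X_m) (rank X_n)` is separable. Exchanging the factors, let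
`r = rank X ≤ rank X_m`. Write `X = B Bᴴ` with `r` columns and let `V_j` be the `m × r` block of `B`
at `j : n`; positivity of the partial transpose says that the block matrix `(V_{j'} V_jᴴ)_{j j'}`
is positive semidefinite. For `e : n → ℂ` put `V_e = ∑ e_j V_j`.

* If `V_eᴴ x = 0`, the block matrix annihilates `x ⊗ e`, so `V_e V_fᴴ x = 0` for every `f`
  (`slice_mul_slice_mulVec_eq_zero`).
* If the rank of `V_e` is maximal in the span of the `V_j`, every `V_f` maps `ker V_e` into
  `range V_e = (ker V_eᴴ)ᗮ` (`exists_mulVec_eq_of_rank_add_smul_le`). Together,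
  `⟪x, V_f V_fᴴ x⟫ = 0`, so `ker V_eᴴ ≤ ker V_fᴴ` for all `f`; thus `ker V_eᴴ ≤ ker X_m`, and the
  rank hypothesis makes `V_e` injective. Hence `V_j = V_e C_j` with square matrices `C_j`
  satisfying `∑ e_j C_j = 1` (`exists_slice_eq_mul`).
* The block matrix `(C_{j'} C_jᴴ)` is positive semidefinite, and its Schur complement in the
  direction `e` is `(C_{j'} C_jᴴ - C_jᴴ C_{j'})`, which has trace zero and therefore vanishes
  (`mul_conjTranspose_eq_of_posSemidef`).
* By Fuglede's theorem the `C_j` are commuting normal matrices; a joint orthonormal eigenbasis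
  `w_k`, `C_j w_k = c_{jk} w_k`, gives `X = ∑ |V_e w_k⟩⟨V_e w_k| ⊗ |c_k⟩⟨c_k|`.

For the second step, a separable decomposition across the cut gives, on tracing out all copies of
`B` but one on the far side of the cut, a separable decomposition of the reduced operator on `A` and
that copy. By Bose symmetry this is the reduced operator on `A` and the first copy
(`isSeparable_reducedAB`).
-/

namespace RankLoop
open Matrix Module

/-! ### Commuting normal matrices -/

open scoped Matrix.Norms.L2Operator in
/-- Fuglede's theorem for matrices; the operator norm enters only to make them a C⋆-algebra. -/
theorem commute_of_commute_conjTranspose {ι : Type*} [Fintype ι] [DecidableEq ι]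
    {C D : Matrix ι ι ℂ} (hC : Commute Cᴴ C) (h : Commute Cᴴ D) : Commute C D := by
  have : IsStarNormal Cᴴ := ⟨by simpa [Matrix.star_eq_conjTranspose] using hC.symm⟩
  have h2 := this.commute_star_left h
  simpa [Matrix.star_eq_conjTranspose] using h2

/-- If `A` has maximal rank on the line `A + t B`, then `B` maps the kernel of `A` into its range:
otherwise `B x`, together with a basis of the range perturbed to vectors `(A + t B) z_k`, would stay
linearly independent in the range of `A + t B` for small `t ≠ 0`. -/
theorem exists_mulVec_eq_of_rank_add_smul_le {m ι : Type*} [Fintype m] [Fintype ι]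
    {A B : Matrix m ι ℂ} (hmax : ∀ t : ℂ, (A + t • B).rank ≤ A.rank) {x : ι → ℂ}
    (hx : A *ᵥ x = 0) : ∃ z, A *ᵥ z = B *ᵥ x := by
  by_contra hne
  have hmem : B *ᵥ x ∉ LinearMap.range A.mulVecLin := by
    rintro ⟨z, hz⟩
    exact hne ⟨z, by simpa using hz⟩
  let bs := Module.finBasis ℂ (LinearMap.range A.mulVecLin)
  choose z hz using fun k => (bs k).2
  let F : ℂ → Option (Fin (finrank ℂ (LinearMap.range A.mulVecLin))) → m → ℂ :=
    fun t o => o.elim (B *ᵥ x) (fun k => (A + t • B) *ᵥ z k)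
  have h0 : LinearIndependent ℂ (F 0) := by
    rw [linearIndependent_option]
    constructor
    · have h1 : LinearIndependent ℂ (fun k => (bs k : m → ℂ)) :=
        bs.linearIndependent.map' (Submodule.subtype _) (Submodule.ker_subtype _)
      convert! h1 using 2 with k
      simpa [F] using hz k
    · intro hsp
      apply hmem
      have : Submodule.span ℂ (Set.range fun k => F 0 (some k)) ≤
          LinearMap.range A.mulVecLin := by
        rw [Submodule.span_le]
        rintro _ ⟨k, rfl⟩
        exact ⟨z k, by simp [F]⟩
      exact this hsp
  have hcont : Continuous F := by
    refine continuous_pi fun o => ?_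
    cases o with
    | none => exact continuous_const
    | some k =>
      simp only [F, Option.elim, Matrix.add_mulVec, Matrix.smul_mulVec]
      fun_prop
  have hev : ∀ᶠ t in nhdsWithin (0 : ℂ) {0}ᶜ, LinearIndependent ℂ (F t) :=
    nhdsWithin_le_nhds (hcont.tendsto 0 |>.eventually h0.eventually)
  obtain ⟨t, ht, ht0⟩ := (hev.and self_mem_nhdsWithin).exists
  have ht0 : t ≠ 0 := ht0
  have hr : ∀ o, F t o ∈ LinearMap.range (A + t • B).mulVecLin := by
    intro o
    cases o with
    | none =>
      refine ⟨t⁻¹ • x, ?_⟩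
      simp [F, Matrix.add_mulVec, Matrix.smul_mulVec, hx, smul_smul, ht0]
    | some k => exact ⟨z k, rfl⟩
  have hli : LinearIndependent ℂ
      (fun o => (⟨F t o, hr o⟩ : LinearMap.range (A + t • B).mulVecLin)) :=
    LinearIndependent.of_comp (Submodule.subtype _) ht
  have hcard := hli.fintype_card_le_finrank
  have := hmax t
  simp only [Fintype.card_option, Fintype.card_fin] at hcard
  simp only [Matrix.rank] at this
  omega

/-- Matrices commuting with each other's adjoints have a joint orthonormal eigenbasis `w`.
Orthonormality is recorded as the resolution of the identity `∑ |w_k⟩⟨w_k| = 1`. -/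
theorem exists_joint_eigenvectors {ι n : Type*} [Fintype ι] [DecidableEq ι]
    {C : n → Matrix ι ι ℂ} (hC : ∀ j j', Commute (C j)ᴴ (C j')) :
    ∃ (r : ℕ) (w : Fin r → ι → ℂ) (c : n → Fin r → ℂ),
      (∑ k, proj (w k) = 1) ∧ ∀ j k, C j *ᵥ w k = c j k • w k := by
  classical
  have hCC : ∀ j j', Commute (C j) (C j') := fun j j' =>
    commute_of_commute_conjTranspose (hC j j) (hC j j')
  have hCC' : ∀ j j', Commute (C j)ᴴ (C j')ᴴ := fun j j' => by
    have := congrArg conjTranspose (hCC j' j).eq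
    simpa [Commute, SemiconjBy] using this
  -- The real and imaginary parts of the `C j`, up to factors `2` and `-2`: commuting Hermitian matrices.
  let S : n × Bool → Matrix ι ι ℂ := fun p =>
    bif p.2 then C p.1 + (C p.1)ᴴ else Complex.I • (C p.1 - (C p.1)ᴴ)
  have hSherm : ∀ p, (S p).IsHermitian := by
    rintro ⟨j, _ | _⟩
    · simp [S, IsHermitian, ← smul_neg]
    · simp [S, IsHermitian, add_comm]
  have hScomm : ∀ p q, Commute (S p) (S q) := by
    have hd : ∀ j j', Commute (C j) (C j')ᴴ := fun j j' => (hC j' j).symm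
    rintro ⟨j, _ | _⟩ ⟨j', _ | _⟩ <;> simp only [S, cond_true, cond_false]
    · exact (((hCC j j').sub_right (hd j j')).sub_left
        ((hC j j').sub_right (hCC' j j'))).smul_left _ |>.smul_right _
    · exact (((hCC j j').add_right (hd j j')).sub_left
        ((hC j j').add_right (hCC' j j'))).smul_left _
    · exact (((hCC j j').sub_right (hd j j')).add_left
        ((hC j j').sub_right (hCC' j j'))).smul_right _
    · exact ((hCC j j').add_right (hd j j')).add_left
        ((hC j j').add_right (hCC' j j'))
  let T : n × Bool → EuclideanSpace ℂ ι →ₗ[ℂ] EuclideanSpace ℂ ι := fun p => toEuclideanLin (S p)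
  have hTs : ∀ p, (T p).IsSymmetric := fun p => isSymmetric_toEuclideanLin_iff.mpr (hSherm p)
  have hTc : Pairwise (Function.onFun Commute T) := by
    intro p q _
    ext x i
    have := congrArg (fun M => (M *ᵥ x.ofLp) i) (hScomm p q).eq
    simpa [T, Matrix.mulVec_mulVec] using this
  -- The joint eigenspaces are indexed by an infinite type; only the nonzero ones are kept.
  have hint := DirectSum.isInternal_ne_bot_iff.mpr
    (LinearMap.IsSymmetric.directSum_isInternal_of_pairwise_commute hTs hTc)
  have hO := LinearMap.IsSymmetric.orthogonalFamily_iInf_eigenspaces hTs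
  have hO' := hO.comp (Subtype.val_injective (p := fun α : n × Bool → ℂ =>
    ⨅ j, Module.End.eigenspace (T j) (α j) ≠ ⊥))
  have : Fintype {α : n × Bool → ℂ // ⨅ j, Module.End.eigenspace (T j) (α j) ≠ ⊥} :=
    (hO.independent).fintypeNeBotOfFiniteDimensional
  let bs := hint.subordinateOrthonormalBasis rfl hO'
  let γ := fun k => (hint.subordinateOrthonormalBasisIndex rfl k hO').1
  have hbs : ∀ k p, S p *ᵥ (bs k).ofLp = γ k p • (bs k).ofLp := by
    intro k p
    have h := hint.subordinateOrthonormalBasis_subordinate rfl k hO'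
    have h := (Submodule.mem_iInf _).mp h p
    rw [Module.End.mem_eigenspace_iff] at h
    exact congrArg WithLp.ofLp h
  refine ⟨_, fun k => (bs k).ofLp,
    fun j k => (2 : ℂ)⁻¹ * (γ k (j, true) - Complex.I * γ k (j, false)), ?_, ?_⟩
  · ext i i'
    have := bs.sum_inner_mul_inner (EuclideanSpace.single i 1) (EuclideanSpace.single i' 1)
    simp only [EuclideanSpace.inner_single_left, EuclideanSpace.inner_single_right, map_one,
      one_mul, PiLp.single_apply] at this
    simpa [proj, Matrix.sum_apply, vecMulVec_apply, Matrix.one_apply, eq_comm (a := i)] using this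
  · intro j k
    have : C j = (2 : ℂ)⁻¹ • (S (j, true) - Complex.I • S (j, false)) := by
      simp only [S, cond_true, cond_false, smul_smul, Complex.I_mul_I]
      module
    rw [this, smul_mulVec, sub_mulVec, smul_mulVec, hbs, hbs]
    module

/-! ### Separable sums and rank factorisations -/

theorem isSeparable_of_sum {m n κ : Type*} [Fintype κ] (p : κ → ℝ) (hp : ∀ k, 0 ≤ p k)
    (u : κ → m → ℂ) (v : κ → n → ℂ) :
    IsSeparable (∑ k, (p k : ℂ) • (proj (u k) ⊗ₖ proj (v k))) := by
  let e := (Fintype.equivFin κ).symm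
  exact ⟨_, p ∘ e, u ∘ e, v ∘ e, fun i => hp _,
    (e.sum_comp fun k => (p k : ℂ) • (proj (u k) ⊗ₖ proj (v k))).symm⟩

/-- Full rank factorisation of a positive semidefinite matrix: the columns of `B` are the
eigenvectors with nonzero eigenvalue, scaled by the square roots of the eigenvalues. -/
theorem exists_eq_mul_conjTranspose {m : Type*} [Fintype m] [DecidableEq m]
    {X : Matrix m m ℂ} (hX : X.PosSemidef) : ∃ B : Matrix m (Fin X.rank) ℂ, X = B * Bᴴ := by
  have hh := hX.isHermitian
  let e : {i // hh.eigenvalues i ≠ 0} ≃ Fin X.rank :=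
    Fintype.equivFinOfCardEq hh.rank_eq_card_non_zero_eigs.symm
  let U : Matrix m m ℂ := hh.eigenvectorUnitary
  let f : m → m → m → ℂ := fun i i' k => U i k * hh.eigenvalues k * star (U i' k)
  refine ⟨Matrix.of fun i k => U i (e.symm k) * (√(hh.eigenvalues (e.symm k)) : ℂ), ?_⟩
  have hs : ∀ i i', X i i' = ∑ k, f i i' k := by
    intro i i'
    conv_lhs => rw [hh.spectral_theorem]
    simp [Unitary.conjStarAlgAut_apply, Matrix.mul_apply, diagonal, U, f, Matrix.star_apply]
  ext i i'
  have h0 : ∀ k, hh.eigenvalues k = 0 → f i i' k = 0 := fun k hk => by simp [f, hk]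
  have hsub : ∑ k, f i i' k = ∑ k : {k // hh.eigenvalues k ≠ 0}, f i i' k := by
    rw [← Finset.sum_subtype (Finset.univ.filter fun k => hh.eigenvalues k ≠ 0) (by simp) (f i i')]
    exact (Finset.sum_filter_of_ne fun k _ hk => mt (h0 k) hk).symm
  rw [hs, hsub, ← e.symm.sum_comp]
  simp only [Matrix.mul_apply, conjTranspose_apply, of_apply, f]
  refine Finset.sum_congr rfl fun k _ => ?_
  have hsq : (√(hh.eigenvalues (e.symm k)) : ℂ) * (√(hh.eigenvalues (e.symm k)) : ℂ) =
      hh.eigenvalues (e.symm k) := by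
    rw [← Complex.ofReal_mul, Real.mul_self_sqrt (hX.eigenvalues_nonneg _)]
  rw [star_mul', ← hsq]
  simp
  ring

/-! ### Low-rank operators with positive partial transpose -/

/-- The block of `B` at `j`: the rows of `B` whose second index is `j`. -/
def slice {m n ι : Type*} (B : Matrix (m × n) ι ℂ) (j : n) : Matrix m ι ℂ :=
  Matrix.of fun i k => B (i, j) k

section
variable {m n ι : Type*} [Fintype m] [Fintype n] [Fintype ι]
  {B : Matrix (m × n) ι ℂ}

omit [Fintype m] [Fintype n] in
theorem mul_conjTranspose_apply_slice (B : Matrix (m × n) ι ℂ) (i i' : m) (j j' : n) :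
    (B * Bᴴ) (i, j) (i', j') = (slice B j * (slice B j')ᴴ) i i' := by
  simp [Matrix.mul_apply, slice]

/-- The partial transpose of `B Bᴴ` has quadratic form `‖V_eᴴ x‖²` at `x ⊗ e`, where `V_e` is the
combination of the blocks of `B` with coefficients `e`. If it vanishes, so does the image of `x ⊗ e`,
whose component at `f` is `V_e V_fᴴ x`. -/
theorem slice_mul_slice_mulVec_eq_zero (hP : (partialTranspose (B * Bᴴ)).PosSemidef)
    {e : n → ℂ} {x : m → ℂ} (hx : (∑ j, e j • slice B j)ᴴ *ᵥ x = 0) (f : n) :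
    (∑ j, e j • slice B j) *ᵥ ((slice B f)ᴴ *ᵥ x) = 0 := by
  have hG : ∀ f i, (partialTranspose (B * Bᴴ) *ᵥ fun q => x q.1 * e q.2) (i, f) =
      ((∑ j, e j • slice B j) *ᵥ ((slice B f)ᴴ *ᵥ x)) i := by
    intro f i
    rw [mulVec_mulVec, Matrix.sum_mul]
    simp only [mulVec, dotProduct, Fintype.sum_prod_type, partialTranspose, of_apply,
      mul_conjTranspose_apply_slice, Matrix.sum_apply, Matrix.smul_mul, Matrix.smul_apply, smul_eq_mul,
      Finset.sum_mul]
    exact Finset.sum_congr rfl fun _ _ => Finset.sum_congr rfl fun _ _ => by ring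
  have h0 : partialTranspose (B * Bᴴ) *ᵥ (fun q => x q.1 * e q.2) = 0 := by
    rw [← hP.dotProduct_mulVec_zero_iff]
    have : star (fun q : m × n => x q.1 * e q.2) ⬝ᵥ
        (partialTranspose (B * Bᴴ) *ᵥ fun q => x q.1 * e q.2) =
        star x ⬝ᵥ ((∑ j, e j • slice B j) *ᵥ ((∑ j, e j • slice B j)ᴴ *ᵥ x)) := by
      have h1 : (∑ j, e j • slice B j)ᴴ *ᵥ x = ∑ j, star (e j) • ((slice B j)ᴴ *ᵥ x) := by
        simp [conjTranspose_sum, sum_mulVec, smul_mulVec]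
      rw [h1]
      simp only [mulVec_sum, mulVec_smul, dotProduct_sum, dotProduct_smul]
      simp only [dotProduct, Fintype.sum_prod_type_right, hG]
      refine Finset.sum_congr rfl fun j _ => ?_
      rw [smul_eq_mul, Finset.mul_sum]
      refine Finset.sum_congr rfl fun i _ => ?_
      simp
      ring
    rw [this, hx]
    simp
  ext i
  rw [← hG, h0]
  simp

omit [Fintype m] in
theorem exists_rank_max (B : Matrix (m × n) ι ℂ) : ∃ e : n → ℂ, ∀ e' : n → ℂ,
    (∑ j, e' j • slice B j).rank ≤ (∑ j, e j • slice B j).rank := by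
  have hfin : (Set.range fun e : n → ℂ => (∑ j, e j • slice B j).rank).Finite :=
    (Set.finite_Iic (Fintype.card ι)).subset (by
      rintro _ ⟨e, rfl⟩
      exact rank_le_card_width _)
  obtain ⟨_, ⟨⟨e, rfl⟩, he⟩⟩ := hfin.exists_maximal ⟨_, 0, rfl⟩
  exact ⟨e, fun e' => by
    by_contra! h
    exact absurd (he ⟨e', rfl⟩ h.le) (not_le.mpr h)⟩

/-- A combination `V_e` of maximal rank has the smallest possible cokernel: `V_fᴴ x` lies in
`ker V_e`, so by maximality `V_f V_fᴴ x` lies in the range of `V_e`, which is orthogonal to `x`. -/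
theorem slice_conjTranspose_mulVec_eq_zero [DecidableEq n]
    (hP : (partialTranspose (B * Bᴴ)).PosSemidef)
    {e : n → ℂ} (he : ∀ e' : n → ℂ,
      (∑ j, e' j • slice B j).rank ≤ (∑ j, e j • slice B j).rank)
    {x : m → ℂ} (hx : (∑ j, e j • slice B j)ᴴ *ᵥ x = 0) (f : n) :
    (slice B f)ᴴ *ᵥ x = 0 := by
  obtain ⟨z, hz⟩ := exists_mulVec_eq_of_rank_add_smul_le (B := slice B f) (fun t => by
    refine le_trans (le_of_eq ?_) (he (e + Pi.single f t))
    simp [add_smul, Finset.sum_add_distrib, Pi.single_apply, ite_smul])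
    (slice_mul_slice_mulVec_eq_zero hP hx f)
  rw [← dotProduct_star_self_eq_zero]
  calc star ((slice B f)ᴴ *ᵥ x) ⬝ᵥ ((slice B f)ᴴ *ᵥ x)
      = star x ⬝ᵥ (slice B f *ᵥ ((slice B f)ᴴ *ᵥ x)) := by
        rw [star_mulVec, conjTranspose_conjTranspose, ← dotProduct_mulVec]
    _ = star ((∑ j, e j • slice B j)ᴴ *ᵥ x) ⬝ᵥ z := by
        rw [← hz, star_mulVec, conjTranspose_conjTranspose, dotProduct_mulVec]
    _ = 0 := by simp [hx]

/-- When `B` has no more columns than the rank of the first reduced operator of `B Bᴴ`, some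
combination `W` of its blocks is left invertible and all blocks factor through it. -/
theorem exists_slice_eq_mul [DecidableEq m] [DecidableEq n] [DecidableEq ι]
    (hP : (partialTranspose (B * Bᴴ)).PosSemidef)
    (hr : Fintype.card ι ≤ (traceSnd (B * Bᴴ)).rank) :
    ∃ (W : Matrix m ι ℂ) (Q : Matrix ι m ℂ) (e : n → ℂ) (C : n → Matrix ι ι ℂ),
      Q * W = 1 ∧ (∑ j, e j • C j = 1) ∧ ∀ j, slice B j = W * C j := by
  obtain ⟨e, he⟩ := exists_rank_max B
  set W := ∑ j, e j • slice B j with hW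
  have hker : ∀ x, Wᴴ *ᵥ x = 0 → ∀ f, (slice B f)ᴴ *ᵥ x = 0 := fun x hx f =>
    slice_conjTranspose_mulVec_eq_zero hP he hx f
  have htr : traceSnd (B * Bᴴ) = ∑ j, slice B j * (slice B j)ᴴ := by
    ext i i'
    simp [traceSnd, mul_conjTranspose_apply_slice, Matrix.sum_apply]
  have hrank : (traceSnd (B * Bᴴ)).rank ≤ W.rank := by
    rw [← rank_conjTranspose W]
    have hle : LinearMap.ker Wᴴ.mulVecLin ≤ LinearMap.ker (traceSnd (B * Bᴴ)).mulVecLin := by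
      intro x hx
      rw [LinearMap.mem_ker, mulVecLin_apply] at hx ⊢
      rw [htr, sum_mulVec]
      exact Finset.sum_eq_zero fun j _ => by rw [← mulVec_mulVec, hker x hx j, mulVec_zero]
    have h1 := LinearMap.finrank_range_add_finrank_ker Wᴴ.mulVecLin
    have h2 := LinearMap.finrank_range_add_finrank_ker (traceSnd (B * Bᴴ)).mulVecLin
    have h3 := Submodule.finrank_mono hle
    simp only [Matrix.rank]
    omega
  have hunit : IsUnit (Wᴴ * W) := by
    have hcard : (Wᴴ * W).rank = Fintype.card ι :=
      le_antisymm (rank_le_card_width _)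
        (by rw [rank_conjTranspose_mul_self]; exact hr.trans hrank)
    rw [← mulVec_surjective_iff_isUnit, ← coe_mulVecLin, ← LinearMap.range_eq_top]
    exact Submodule.eq_top_of_finrank_eq (by simpa [Matrix.rank] using hcard)
  have hdet := (isUnit_iff_isUnit_det _).mp hunit
  -- The left inverse `Q` of `W` for which `W * Q` is the orthogonal projection onto `range W`.
  refine ⟨W, (Wᴴ * W)⁻¹ * Wᴴ, e, fun j => (Wᴴ * W)⁻¹ * Wᴴ * slice B j, ?_, ?_, ?_⟩
  · rw [Matrix.mul_assoc, nonsing_inv_mul _ hdet]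
  · simp only [← Matrix.mul_smul]
    rw [← Matrix.mul_sum, ← hW, Matrix.mul_assoc, nonsing_inv_mul _ hdet]
  · intro j
    have h1 : Wᴴ * (1 - W * ((Wᴴ * W)⁻¹ * Wᴴ)) = 0 := by
      rw [Matrix.mul_sub, ← Matrix.mul_assoc, ← Matrix.mul_assoc, mul_nonsing_inv _ hdet]
      simp
    have h2 : (slice B j)ᴴ * (1 - W * ((Wᴴ * W)⁻¹ * Wᴴ)) = 0 := by
      ext i k
      have := hker (fun l => (1 - W * ((Wᴴ * W)⁻¹ * Wᴴ) : Matrix m m ℂ) l k)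
        (funext fun i' => congrFun (congrFun h1 i') k) j
      exact congrFun this i
    have h3 := congrArg conjTranspose h2
    simp only [conjTranspose_mul, conjTranspose_sub, conjTranspose_one,
      conjTranspose_conjTranspose, conjTranspose_zero, conjTranspose_nonsing_inv,
      Matrix.sub_mul, Matrix.one_mul, sub_eq_zero] at h3
    rw [h3]
    simp only [Matrix.mul_assoc]

/-- Positivity of the block matrix with blocks `C_{j'} C_jᴴ` forces `C_{j'}` and `C_jᴴ` to commute,
provided that some combination of the `C_j` is the identity. -/
theorem mul_conjTranspose_eq_of_posSemidef [DecidableEq n] [DecidableEq ι]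
    {C : n → Matrix ι ι ℂ} {e : n → ℂ} (he : ∑ j, e j • C j = 1)
    (hH : (Matrix.of fun p q : ι × n => (C q.2 * (C p.2)ᴴ) p.1 q.1).PosSemidef) (j j' : n) :
    C j' * (C j)ᴴ = (C j)ᴴ * C j' := by
  set H : Matrix (ι × n) (ι × n) ℂ := Matrix.of fun p q => (C q.2 * (C p.2)ᴴ) p.1 q.1
  let R : Matrix ι (ι × n) ℂ := Matrix.of fun k q => C q.2 k q.1
  let E : Matrix (ι × n) ι ℂ := Matrix.of fun q k => if q.1 = k then e q.2 else 0
  -- `E` embeds `ℂ^ι` in the direction `e`, where `H` restricts to `Eᴴ H E = 1`, and `H - Rᴴ R` is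
  -- the Schur complement of `H` with respect to it.
  have hRE : R * E = 1 := by
    rw [← he]
    ext k k'
    simp [R, E, Matrix.mul_apply, Fintype.sum_prod_type_right, Matrix.sum_apply, mul_comm]
  have hHE : H * E = Rᴴ := by
    ext ⟨k, j⟩ k'
    have : (∑ j', (e j' • C j') * (C j)ᴴ) k k' = (C j)ᴴ k k' := by
      rw [← Matrix.sum_mul, he, Matrix.one_mul]
    simp only [Matrix.sum_apply, Matrix.smul_mul] at this
    simpa [R, E, H, Matrix.mul_apply, Fintype.sum_prod_type_right,
      mul_comm] using this
  have hER : Eᴴ * Rᴴ = 1 := by rw [← conjTranspose_mul, hRE, conjTranspose_one]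
  have hEH : Eᴴ * H = R := by
    have := congrArg conjTranspose hHE
    rwa [conjTranspose_mul, hH.isHermitian.eq, conjTranspose_conjTranspose] at this
  have hD : (H - Rᴴ * R).PosSemidef := by
    convert! hH.conjTranspose_mul_mul_same (1 - E * R) using 1
    have : (1 - E * R)ᴴ * H = H - Rᴴ * R := by
      rw [conjTranspose_sub, conjTranspose_one, conjTranspose_mul, Matrix.sub_mul,
        Matrix.one_mul, Matrix.mul_assoc, hEH]
    rw [this, Matrix.mul_sub, Matrix.mul_one, Matrix.sub_mul, ← Matrix.mul_assoc, hHE,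
      ← Matrix.mul_assoc, Matrix.mul_assoc Rᴴ R E, hRE, Matrix.mul_one, sub_self, sub_zero]
  have htr : (H - Rᴴ * R).trace = 0 := by
    rw [trace_sub, trace_mul_comm, sub_eq_zero]
    simp only [trace, diag_apply, H, R, Matrix.mul_apply, Fintype.sum_prod_type, of_apply,
      conjTranspose_apply]
    exact Finset.sum_congr rfl fun _ _ => Finset.sum_comm
  have h0 := sub_eq_zero.mp (hD.trace_eq_zero_iff.mp htr)
  ext k k'
  have := congrFun (congrFun h0 (k, j)) (k', j')
  simpa [H, R, Matrix.mul_apply] using this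

/-- A PPT operator whose rank is at most that of its first reduced operator is separable. -/
theorem isSeparable_of_rank_le_traceSnd [DecidableEq m] [DecidableEq n]
    {X : Matrix (m × n) (m × n) ℂ} (hX : X.PosSemidef) (hP : (partialTranspose X).PosSemidef)
    (hr : X.rank ≤ (traceSnd X).rank) : IsSeparable X := by
  obtain ⟨B, hB⟩ := exists_eq_mul_conjTranspose hX
  generalize X.rank = s at B hr
  subst hB
  obtain ⟨W, Q, e, C, hQW, heC, hC⟩ := exists_slice_eq_mul hP (by simpa using hr)
  have hcomm : ∀ j j', Commute (C j)ᴴ (C j') := by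
    intro j j'
    refine (mul_conjTranspose_eq_of_posSemidef heC ?_ j j').symm
    convert! hP.mul_mul_conjTranspose_same (Q ⊗ₖ (1 : Matrix n n ℂ)) using 1
    ext ⟨k, j⟩ ⟨k', j'⟩
    have h1 : C j' * (C j)ᴴ = Q * (slice B j' * (slice B j)ᴴ) * Qᴴ := by
      have hWQ : Wᴴ * Qᴴ = 1 := by rw [← conjTranspose_mul, hQW, conjTranspose_one]
      rw [hC, hC, conjTranspose_mul, Matrix.mul_assoc, Matrix.mul_assoc, Matrix.mul_assoc,
        Matrix.mul_assoc, hWQ, ← Matrix.mul_assoc, hQW, Matrix.one_mul, Matrix.mul_one]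
    rw [of_apply, h1]
    simp only [Matrix.mul_apply, Fintype.sum_prod_type, kroneckerMap_apply, conjTranspose_apply,
      partialTranspose, of_apply, slice]
    simp [one_apply, apply_ite (starRingEnd ℂ)]
  obtain ⟨r, w, c, hw, hcw⟩ := exists_joint_eigenvectors hcomm
  refine ⟨r, fun _ => 1, fun k => W *ᵥ w k, fun k j => c j k, by simp, ?_⟩
  have hCC : ∀ j j', C j * (C j')ᴴ = ∑ k, (c j k * star (c j' k)) • proj (w k) := by
    intro j j'
    calc C j * (C j')ᴴ = C j * (∑ k, proj (w k)) * (C j')ᴴ := by rw [hw, Matrix.mul_one]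
      _ = _ := by
        rw [Matrix.mul_sum, Matrix.sum_mul]
        refine Finset.sum_congr rfl fun k _ => ?_
        rw [proj, mul_vecMulVec, hcw, vecMulVec_mul, ← star_mulVec, hcw]
        ext; simp [vecMulVec_apply]; ring
  ext ⟨i, j⟩ ⟨i', j'⟩
  rw [mul_conjTranspose_apply_slice, hC, hC, conjTranspose_mul]
  have : W * C j * ((C j')ᴴ * Wᴴ) = ∑ k, (c j k * star (c j' k)) • proj (W *ᵥ w k) := by
    rw [← Matrix.mul_assoc, Matrix.mul_assoc W, hCC, Matrix.mul_sum, Matrix.sum_mul]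
    refine Finset.sum_congr rfl fun k _ => ?_
    rw [Matrix.mul_smul, Matrix.smul_mul, proj, mul_vecMulVec, vecMulVec_mul, ← star_mulVec, proj]
  rw [this]
  simp only [Matrix.sum_apply, Matrix.smul_apply, kroneckerMap_apply, proj, vecMulVec_apply]
  simp [mul_comm]
end

theorem IsSeparable.of_swap {m n : Type*} {X : Matrix (m × n) (m × n) ℂ}
    (h : IsSeparable (X.submatrix (Prod.swap : n × m → m × n) Prod.swap)) : IsSeparable X := by
  obtain ⟨r, p, u, v, hp, h⟩ := h
  refine ⟨r, p, v, u, hp, ?_⟩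
  ext ⟨i, j⟩ ⟨i', j'⟩
  have := congrFun (congrFun h (j, i)) (j', i')
  simpa [Matrix.sum_apply, mul_comm] using this

/-- A PPT operator whose rank is at most the larger rank of its two reduced operators is
separable. -/
theorem isSeparable_of_rank_le_max {m n : Type*} [Fintype m] [Fintype n] [DecidableEq m]
    [DecidableEq n] {X : Matrix (m × n) (m × n) ℂ} (hX : X.PosSemidef)
    (hP : (partialTranspose X).PosSemidef)
    (hr : X.rank ≤ max (traceSnd X).rank (traceFst X).rank) : IsSeparable X := by
  rcases le_max_iff.mp hr with h | h
  · exact isSeparable_of_rank_le_traceSnd hX hP h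
  · refine IsSeparable.of_swap (isSeparable_of_rank_le_traceSnd (hX.submatrix _) ?_ ?_)
    -- The partial transpose on the first factor is the transpose of that on the second.
    · exact hP.transpose.submatrix (Prod.swap : n × m → m × n)
    · exact (rank_submatrix X (Equiv.prodComm n m) (Equiv.prodComm n m)).trans_le h

/-! ### Bose symmetry and the reduced operator -/

theorem symProj_mul_permOp (N : ℕ) (b : Type*) [Fintype b] [DecidableEq b]
    (σ : Equiv.Perm (Fin N)) : symProj N b * permOp N b σ = symProj N b := by
  have h : ∀ τ, permOp N b τ * permOp N b σ = permOp N b (σ * τ) := by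
    intro τ
    ext x y
    simp [permOp, Matrix.mul_apply, Function.comp_assoc]
    congr
  rw [symProj, Matrix.smul_mul, Matrix.sum_mul]
  congr 1
  simp only [h]
  exact Equiv.sum_comp (Equiv.mulLeft σ) (permOp N b)

section
variable {a b : Type*} [Fintype a] [Fintype b] [DecidableEq a] [DecidableEq b] {N : ℕ}
  {L : Matrix (a × (Fin N → b)) (a × (Fin N → b)) ℂ}

theorem apply_comp_right_of_bose (hb : L * ((1 : Matrix a a ℂ) ⊗ₖ symProj N b) = L)
    (σ : Equiv.Perm (Fin N)) (p : a × (Fin N → b)) (i : a) (x : Fin N → b) :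
    L p (i, x ∘ σ) = L p (i, x) := by
  have h : L * ((1 : Matrix a a ℂ) ⊗ₖ permOp N b σ) = L := by
    conv_lhs => rw [← hb]
    rw [Matrix.mul_assoc, ← mul_kronecker_mul, Matrix.one_mul, symProj_mul_permOp, hb]
  conv_rhs => rw [← h]
  simp [Matrix.mul_apply, Fintype.sum_prod_type, permOp, one_apply]

theorem apply_comp_comp_of_bose (hL : L.IsHermitian)
    (hb : L * ((1 : Matrix a a ℂ) ⊗ₖ symProj N b) = L)
    (σ : Equiv.Perm (Fin N)) (i i' : a) (x x' : Fin N → b) :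
    L (i, x ∘ σ) (i', x' ∘ σ) = L (i, x) (i', x') := by
  rw [apply_comp_right_of_bose hb, ← hL.apply, apply_comp_right_of_bose hb, hL.apply]

omit [DecidableEq a] [Fintype a] in
theorem sum_ite_update {κ : Type*} [Fintype κ] [DecidableEq κ] (l : κ)
    (G : (κ → b) → (κ → b) → ℂ) (β β' : b) :
    (∑ x, if x l = β then G x (Function.update x l β') else 0) =
      ∑ w, G ((Equiv.funSplitAt l b).symm (β, w)) ((Equiv.funSplitAt l b).symm (β', w)) := by
  rw [← (Equiv.funSplitAt l b).symm.sum_comp, Fintype.sum_prod_type]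
  have : ∀ (γ : b) (y : {j : κ // j ≠ l} → b),
      Function.update ((Equiv.funSplitAt l b).symm (γ, y)) l β' =
        (Equiv.funSplitAt l b).symm (β', y) := by
    intro γ y
    ext k
    by_cases hk : k = l
    · subst hk; simp [Equiv.funSplitAt]
    · simp [Equiv.funSplitAt, hk]
  simp only [this]
  simp [Equiv.funSplitAt, Finset.sum_ite_irrel]

omit [Fintype a] [DecidableEq a] in
theorem reducedAB_apply [NeZero N] (L : Matrix (a × (Fin N → b)) (a × (Fin N → b)) ℂ)
    (i i' : a) (β β' : b) : reducedAB L (i, β) (i', β') =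
      ∑ x : Fin N → b, if x 0 = β then L (i, x) (i', Function.update x 0 β') else 0 := by
  rw [sum_ite_update 0 (fun x x' => L (i, x) (i', x'))]
  rfl

/-- For a Bose symmetric operator every copy of `B` has the same joint reduced operator with `A`. -/
theorem reducedAB_apply_of_bose [NeZero N] (hL : L.IsHermitian)
    (hb : L * ((1 : Matrix a a ℂ) ⊗ₖ symProj N b) = L) (l : Fin N)
    (i i' : a) (β β' : b) : reducedAB L (i, β) (i', β') =
      ∑ x : Fin N → b, if x l = β then L (i, x) (i', Function.update x l β') else 0 := by
  rw [reducedAB_apply, ← (Equiv.arrowCongr (Equiv.swap 0 l) (Equiv.refl b)).sum_comp]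
  refine Finset.sum_congr rfl fun x _ => ?_
  have h1 : (Equiv.arrowCongr (Equiv.swap 0 l) (Equiv.refl b)) x = x ∘ Equiv.swap 0 l := by
    ext; simp
  have h2 : Function.update (x ∘ Equiv.swap 0 l) 0 β' =
      Function.update x l β' ∘ Equiv.swap 0 l := by
    rw [Function.update_comp_equiv]; simp
  rw [h1, h2, apply_comp_comp_of_bose hL hb]
  simp

/-- The first copy of `B` may be replaced by the copy with index `K`, which lies beyond the cut; tracing
out all other copies then acts separately on the two factors of each product term. -/
theorem isSeparable_reducedAB [NeZero N] {K : ℕ} (hK : K < N) (hL : L.IsHermitian)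
    (hb : L * ((1 : Matrix a a ℂ) ⊗ₖ symProj N b) = L) (hs : IsSeparable (cut K L)) :
    IsSeparable (reducedAB L) := by
  obtain ⟨r, p, u, v, hp, h⟩ := hs
  let l : {i : Fin N // ¬ (i : ℕ) < K} := ⟨⟨K, hK⟩, by simp⟩
  have hLe : ∀ i i' (y : {i : Fin N // (i : ℕ) < K} → b) z z',
      L (i, (Equiv.piEquivPiSubtypeProd (fun i : Fin N => (i : ℕ) < K) fun _ => b).symm (y, z))
        (i', (Equiv.piEquivPiSubtypeProd (fun i : Fin N => (i : ℕ) < K) fun _ => b).symm (y, z'))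
      = ∑ k, (p k : ℂ) * (u k (i, y) * star (u k (i', y)) * (v k z * star (v k z'))) := by
    intro i i' y z z'
    have := congrFun (congrFun h ((i, y), z)) ((i', y), z')
    simpa [cut, cutSplit, Matrix.sum_apply, proj, vecMulVec_apply] using this
  have key : reducedAB L = ∑ q : Fin r × ({i : Fin N // (i : ℕ) < K} → b) ×
      ({i : {i : Fin N // ¬ (i : ℕ) < K} // i ≠ l} → b),
      (p q.1 : ℂ) • (proj (fun i => u q.1 (i, q.2.1)) ⊗ₖ
        proj (fun β => v q.1 ((Equiv.funSplitAt l b).symm (β, q.2.2)))) := by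
    ext ⟨i, β⟩ ⟨i', β'⟩
    rw [reducedAB_apply_of_bose hL hb l.1, ← (Equiv.piEquivPiSubtypeProd
      (fun i : Fin N => (i : ℕ) < K) fun _ => b).symm.sum_comp, Fintype.sum_prod_type,
      Matrix.sum_apply]
    have hl : ∀ (y : {i : Fin N // (i : ℕ) < K} → b) z,
        (Equiv.piEquivPiSubtypeProd (fun i : Fin N => (i : ℕ) < K) fun _ => b).symm (y, z) l.1
          = z l := fun y z => by simp [l]
    have hupd : ∀ (y : {i : Fin N // (i : ℕ) < K} → b) z, Function.update
        ((Equiv.piEquivPiSubtypeProd (fun i : Fin N => (i : ℕ) < K) fun _ => b).symm (y, z))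
          l.1 β' = (Equiv.piEquivPiSubtypeProd (fun i : Fin N => (i : ℕ) < K) fun _ => b).symm
            (y, Function.update z l β') := by
      intro y z
      ext k
      by_cases hk : (k : ℕ) < K
      · have : k ≠ l.1 := by rintro rfl; exact l.2 hk
        simp [hk, this]
      · simp [hk, Function.update_apply, Subtype.ext_iff]
    simp only [hl, hupd, hLe]
    simp only [Fintype.sum_prod_type]
    refine Eq.trans ?_ Finset.sum_comm
    refine Finset.sum_congr rfl fun y _ => ?_
    rw [sum_ite_update l (fun z z' => ∑ k, (p k : ℂ) *
      (u k (i, y) * star (u k (i', y)) * (v k z * star (v k z')))), Finset.sum_comm]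
    simp [proj, vecMulVec_apply]
  rw [key]
  exact isSeparable_of_sum _ (fun _ => hp _) _ _
end

end RankLoop

theorem mainTheorem8 {a b : Type*} [Fintype a] [Fintype b] [DecidableEq a] [DecidableEq b]
    (N K : ℕ) [NeZero N] (hK : K < N)
    (X : Matrix (a × b) (a × b) ℂ)
    (L : Matrix (a × (Fin N → b)) (a × (Fin N → b)) ℂ)
    (hBSE : RankLoop.IsBSE X L) (hPPT : RankLoop.IsPPT K L)
    (hrank : L.rank ≤ max (RankLoop.reducedABK K L).rank (RankLoop.reducedBNK K L).rank) :
    RankLoop.IsSeparable X := by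
  have hcut : (RankLoop.cut K L).PosSemidef := hBSE.posSemidef.submatrix _
  rw [← hBSE.trace_eq]
  refine RankLoop.isSeparable_reducedAB hK hBSE.posSemidef.isHermitian hBSE.bose
    (RankLoop.isSeparable_of_rank_le_max hcut hPPT ?_)
  rwa [RankLoop.cut, Matrix.rank_reindex]
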